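/- Let $(\mathcal V,\otimes,\mathbf 1)$ be a monoidal category that is closed (every functor $A\otimes-$ has a right adjoint) and locally presentable. A family of morphisms $(\beta_i:B\to B_i)_{i\in I}$ is called jointly monic if $f=g$ whenever $f,g:Z\to B$ satisfy $\beta_i f=\beta_i g$ for all $i\in I$. Assume that the monoidal product is very flat: for every object $A$ and every jointly monic family $(\beta_i:B\to B_i)_{i\in I}$ indexed by a non-empty set $I$, the families $(\beta_i\otimes \mathrm{id}_A:B\otimes A\to B_i\otimes A)_{i\in I}$ and $(\mathrm{id}_A\otimes\beta_i:A\otimes B\to A\otimes B_i)_{i\in I}$ are again jointly monic. Let $\mathsf{Coalg}(\mathcal V)$ be the category of (coassociative, counital) coalgebras in $\mathcal V$. Then the forgetful functor $\mathsf{Coalg}(\mathcal V)\to\mathcal V$ has a right adjoint $T^c$ (the cofree coalgebra functor), and the following hold. 1. If $\mathcal V$ carries a symmetry $\sigma$ for its monoidal structure, then for every $V$ in $\mathcal V$ there is an isomorphism of coalgebras $t_V:T^c(V)\to T^c(V)^{cop}$, natural in $V$ and involutive, i.e. $t_V\circ t_V=\mathrm{id}$ as morphisms of $\mathcal V$. Here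 $C^{cop}$ denotes, for a coalgebra $(C,\Delta,\epsilon)$, the coalgebra $(C,\sigma_{C,C}\circ\Delta,\epsilon)$. 2. For a category $\mathcal W$, let $\mathcal W\text{-}\mathsf{Grph}$ be the category whose objects are pairs $(A^0,(A_{x,y})_{x,y\in A^0})$ of a set $A^0$ and a family of objects of $\mathcal W$, and whose morphisms $A\to B$ are pairs of a map $f:A^0\to B^0$ and a family of morphisms $A_{x,y}\to B_{f(x),f(y)}$ in $\mathcal W$. The forgetful functor $\mathsf{Coalg}(\mathcal V)\text{-}\mathsf{Grph}\to\mathcal V\text{-}\mathsf{Grph}$, which keeps the set of objects and applies $\mathsf{Coalg}(\mathcal V)\to\mathcal V$ to all Hom-objects, has a right adjoint. -/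

import Mathlib

open CategoryTheory MonoidalCategory ComonObj

universe w v u v' u'

/-- A family of morphisms `β i : B ⟶ Bᵢ` with common domain is jointly monic if two parallel
morphisms into `B` agree as soon as all their composites with the `β i` agree. -/
def JointlyMonic {V : Type u} [Category.{v} V] {ι : Type w} {B : V} {Bi : ι → V}
    (β : ∀ i, B ⟶ Bi i) : Prop :=
  ∀ ⦃Z : V⦄ (f g : Z ⟶ B), (∀ i, f ≫ β i = g ≫ β i) → f = g

/-- `V` has a very flat monoidal product: for every object `A`, both endofunctors `- ⊗ A` and
`A ⊗ -` preserve jointly monic families indexed by arbitrary nonempty (small) sets.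
The empty family is left out: it is jointly monic on `B` only if `B` is subterminal, and already
for the cartesian category of sets it is not preserved by the functors `- × A`. -/
class VeryFlatTensor (V : Type u) [Category.{v} V] [MonoidalCategory V] : Prop where
  whiskerRight : ∀ (A : V) {ι : Type v} [Nonempty ι] {B : V} {Bi : ι → V} (β : ∀ i, B ⟶ Bi i),
    JointlyMonic β → JointlyMonic (fun i => β i ▷ A)
  whiskerLeft : ∀ (A : V) {ι : Type v} [Nonempty ι] {B : V} {Bi : ι → V} (β : ∀ i, B ⟶ Bi i),
    JointlyMonic β → JointlyMonic (fun i => A ◁ β i)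

/-- A `V`-graph: a set `A⁰` of objects and a family `A_{x,y}` of objects of `V` indexed by
`A⁰ × A⁰`. -/
structure VGraph (V : Type u) where
  obj : Type w
  hom : obj → obj → V

namespace VGraph

/-- A morphism of `V`-graphs: a map `f⁰ : A⁰ → B⁰` together with morphisms
`A_{x,y} ⟶ B_{f x, f y}` in `V`. -/
@[ext]
structure Hom {V : Type u} [Category.{v} V] (A B : VGraph.{w} V) where
  onObj : A.obj → B.obj
  onHom : ∀ x y : A.obj, A.hom x y ⟶ B.hom (onObj x) (onObj y)

/-- The category of `V`-graphs. -/
instance {V : Type u} [Category.{v} V] : Category (VGraph.{w} V) where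
  Hom A B := Hom A B
  id A := ⟨fun x => x, fun x y => 𝟙 (A.hom x y)⟩
  comp f g := ⟨fun x => g.onObj (f.onObj x),
    fun x y => f.onHom x y ≫ g.onHom (f.onObj x) (f.onObj y)⟩
  id_comp f := by
    apply Hom.ext
    · rfl
    · simp
  comp_id f := by
    apply Hom.ext
    · rfl
    · simp
  assoc f g h := by
    apply Hom.ext
    · rfl
    · simp

/-- The functor on graphs induced componentwise by a functor `F : V ⥤ W`; it does not change the
sets of objects. -/
def mapFunctor {V : Type u} [Category.{v} V] {W : Type u'} [Category.{v'} W] (F : V ⥤ W) :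
    VGraph.{w} V ⥤ VGraph.{w} W where
  obj A := ⟨A.obj, fun x y => F.obj (A.hom x y)⟩
  map f := ⟨f.onObj, fun x y => F.map (f.onHom x y)⟩
  map_id A := by
    apply Hom.ext
    · rfl
    · apply heq_of_eq
      funext x y
      exact F.map_id _
  map_comp f g := by
    apply Hom.ext
    · rfl
    · apply heq_of_eq
      funext x y
      exact F.map_comp _ _

end VGraph

/-- The co-opposite of a coalgebra: the same underlying object and counit, and the
comultiplication followed by the symmetry. -/
def copObj {V : Type u} [Category.{v} V] [MonoidalCategory V] [BraidedCategory V]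
    (C : Comon V) : Comon V where
  X := C.X
  comon :=
    { counit := ε[C.X]
      comul := Δ[C.X] ≫ (β_ C.X C.X).hom
      counit_comul := by
        rw [Category.assoc, ← BraidedCategory.braiding_naturality_right, comul_counit_assoc]
        simp
      comul_counit := by
        rw [Category.assoc, ← BraidedCategory.braiding_naturality_left, counit_comul_assoc]
        simp
      comul_assoc := by
        simp only [Category.assoc, MonoidalCategory.whiskerLeft_comp, comp_whiskerRight]
        rw [← BraidedCategory.braiding_naturality_left_assoc,
          ← BraidedCategory.braiding_naturality_right_assoc, comul_assoc_assoc]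
        simp only [BraidedCategory.braiding_tensor_left_hom,
          BraidedCategory.braiding_tensor_right_hom, Category.assoc, Iso.hom_inv_id_assoc]
        simpa using congrArg (fun k : C.X ⊗ C.X ⊗ C.X ⟶ C.X ⊗ C.X ⊗ C.X =>
          Δ[C.X] ≫ Δ[C.X] ▷ C.X ≫ (α_ C.X C.X C.X).hom ≫ k)
          (BraidedCategory.yang_baxter C.X C.X C.X).symm }

/-- The functor `C ↦ C^cop` on coalgebras; it does not change underlying morphisms. -/
def cop (V : Type u) [Category.{v} V] [MonoidalCategory V] [BraidedCategory V] :
    Comon V ⥤ Comon V where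
  obj C := copObj C
  map {C D} f :=
    { hom := (f.hom : C.X ⟶ D.X)
      isComonHom_hom :=
        { hom_counit := IsComonHom.hom_counit f.hom
          hom_comul := by
            change f.hom ≫ Δ[D.X] ≫ (β_ D.X D.X).hom =
              (Δ[C.X] ≫ (β_ C.X C.X).hom) ≫ (f.hom ⊗ₘ f.hom)
            rw [IsComonHom.hom_comul_assoc, Category.assoc, BraidedCategory.braiding_naturality] } }
  map_id _ := rfl
  map_comp _ _ := rfl

/-!
Iterated comultiplication turns a morphism `g : D ⟶ X` from a coalgebra into morphisms from `D` to
all tensor powers of `X`; call `g` cogenerating if these are jointly monic. By very flatness the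
tensor products of any two of them are then jointly monic on `D ⊗ D`. Hence, for cogenerating `g`, a
morphism into `D` compatible with the tensor powers is a coalgebra morphism, and the image of any
coalgebra over `X` in the product of the tensor powers of `X` inherits a coalgebra structure for
which its morphism to `X` is cogenerating. Cogenerating coalgebras over `X` are thus determined by
subobjects of that product, so they form a small family up to isomorphism, and the image of the
coproduct of this family is the cofree coalgebra on `X`.

The involution comes from uniqueness: `C ↦ C^cop` is a self-equivalence over `V`, so composing it
with a right adjoint of the forgetful functor gives another one.
-/

open Limits

section JointlyMonic

variable {V : Type u} [Category.{v} V] {ι : Type w} {B : V} {E : ι → V} {β : ∀ i, B ⟶ E i}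

namespace JointlyMonic

theorem comp_surjective {κ : Type*} (hβ : JointlyMonic β) {r : κ → ι}
    (hr : Function.Surjective r) : JointlyMonic fun k => β (r k) :=
  fun _ f g h => hβ f g (hr.forall.mpr h)

theorem mono_comp {A : V} (hβ : JointlyMonic β) (m : A ⟶ B) [Mono m] :
    JointlyMonic fun i => m ≫ β i :=
  fun _ f g h => (cancel_mono m).mp (hβ _ _ fun i => by simpa only [Category.assoc] using h i)

theorem pi_π [HasProduct E] : JointlyMonic (Pi.π E) :=
  fun _ f g h => Pi.hom_ext f g h

theorem mono_piLift [HasProduct E] (hβ : JointlyMonic β) : Mono (Pi.lift β) where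
  right_cancellation f g h := hβ f g fun i => by
    simpa only [Category.assoc, Pi.lift_π] using congrArg (· ≫ Pi.π E i) h

theorem exists_lift_of_strongEpi [HasProduct E] (hβ : JointlyMonic β) {C D : V} (e : C ⟶ D)
    [StrongEpi e] {u : C ⟶ B} {b : ∀ i, D ⟶ E i} (h : ∀ i, u ≫ β i = e ≫ b i) :
    ∃ l : D ⟶ B, e ≫ l = u := by
  have := hβ.mono_piLift
  have sq : CommSq u e (Pi.lift β) (Pi.lift b) := ⟨Pi.hom_ext _ _ fun i => by simp [h]⟩
  exact ⟨sq.lift, sq.fac_left⟩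

variable [MonoidalCategory V] [VeryFlatTensor V]

theorem whiskerRight [Nonempty ι] [Small.{v} ι] (hβ : JointlyMonic β) (A : V) :
    JointlyMonic fun i => β i ▷ A :=
  have := (equivShrink.{v} ι).symm.nonempty
  fun _ f g h => VeryFlatTensor.whiskerRight A _
    (hβ.comp_surjective (equivShrink.{v} ι).symm.surjective) f g fun _ => h _

theorem whiskerLeft [Nonempty ι] [Small.{v} ι] (hβ : JointlyMonic β) (A : V) :
    JointlyMonic fun i => A ◁ β i :=
  have := (equivShrink.{v} ι).symm.nonempty
  fun _ f g h => VeryFlatTensor.whiskerLeft A _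
    (hβ.comp_surjective (equivShrink.{v} ι).symm.surjective) f g fun _ => h _

theorem tensorHom {κ : Type*} [Nonempty ι] [Small.{v} ι] [Nonempty κ] [Small.{v} κ]
    (hβ : JointlyMonic β) {C : V} {F : κ → V} {γ : ∀ k, C ⟶ F k} (hγ : JointlyMonic γ) :
    JointlyMonic fun p : ι × κ => β p.1 ⊗ₘ γ p.2 := by
  intro Z f g h
  refine hβ.whiskerRight C f g fun i => hγ.whiskerLeft (E i) _ _ fun k => ?_
  simpa only [Category.assoc, MonoidalCategory.tensorHom_def] using h (i, k)

end JointlyMonic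

end JointlyMonic

section LocallyPresentable

theorem hasLimits_of_isDense {A : Type v} [SmallCategory A] {V : Type u} [Category.{v} V]
    [HasColimits V] (F : A ⥤ V) [F.IsDense] : HasLimits V := by
  let L := uliftYoneda.{v}.leftKanExtension F
  let adj : L ⊣ Presheaf.restrictedULiftYoneda.{v} F :=
    Presheaf.uliftYonedaAdjunction L (uliftYoneda.{v}.leftKanExtensionUnit F)
  have : Reflective (Presheaf.restrictedULiftYoneda.{v} F) := { L := L, adj := adj }
  exact hasLimits_of_reflective (Presheaf.restrictedULiftYoneda.{v} F)

theorem isDetecting_of_isStrongGenerator {C : Type u} [Category.{v} C] {P : ObjectProperty C}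
    (hP : P.IsStrongGenerator) : P.IsDetecting := by
  intro X Y f hf
  have : Mono f := ⟨fun {Z} g h hgh => hP.isSeparating _ _ fun G hG k =>
    (hf G hG (k ≫ g ≫ f)).unique (Category.assoc _ _ _) (by rw [hgh, Category.assoc])⟩
  exact hP.isIso_of_mono f fun G hG k => (hf G hG k).exists

variable (V : Type u) [Category.{v} V]

instance hasColimits_of_isLocallyPresentable [IsLocallyPresentable.{w} V] :
    HasColimitsOfSize.{w, w} V := by
  obtain ⟨κ, _, _⟩ := IsLocallyPresentable.exists_cardinal.{w} V
  infer_instance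

instance hasLimits_of_isLocallyPresentable [IsLocallyPresentable.{v} V] : HasLimits V := by
  obtain ⟨κ, _, _⟩ := IsLocallyPresentable.exists_cardinal.{v} V
  let P := isCardinalPresentable V κ
  exact hasLimits_of_isDense ((equivSmallModel.{v} P.FullSubcategory).inverse ⋙ P.ι)

instance wellPowered_of_isLocallyPresentable [IsLocallyPresentable.{v} V] :
    WellPowered.{v} V := by
  obtain ⟨κ, _, _⟩ := IsLocallyPresentable.exists_cardinal.{v} V
  obtain ⟨P, _, hP⟩ := HasCardinalFilteredGenerator.exists_small_generator V κ
  exact wellPowered_of_isDetecting (isDetecting_of_isStrongGenerator hP.isStrongGenerator)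

variable {V} in
theorem subobject_sInf_factors [LocallySmall.{w} V] [WellPowered.{w} V]
    [HasWidePullbacks.{w} V] {X Y : V} {f : X ⟶ Y} {s : Set (Subobject Y)}
    (hs : ∀ S ∈ s, S.Factors f) :
    (Subobject.sInf.{w} s).Factors f := by
  have hmem (j : equivShrink.{w} (Subobject Y) '' s) :
      (equivShrink.{w} (Subobject Y)).symm j ∈ s := by
    obtain ⟨_, S, hS, rfl⟩ := j
    simpa using hS
  let c : Cone (Subobject.wideCospan s) := WidePullbackShape.mkCone f
    (fun j => Subobject.factorThru _ f (hs _ (hmem j))) fun j => Subobject.factorThru_arrow _ _ _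
  exact (Subobject.mk_factors_iff _ _).mpr ⟨limit.lift _ c, limit.lift_π c none⟩

instance hasImages_of_wellPowered [WellPowered.{v} V] [HasWidePullbacks.{v} V] : HasImages V where
  has_image {X Y} f := by
    let I : Subobject Y := Subobject.sInf.{v} {S | S.Factors f}
    have hI : I.Factors f := subobject_sInf_factors fun _ hS => hS
    have hle (F : MonoFactorisation f) : I ≤ Subobject.mk F.m :=
      Subobject.sInf_le _ _ ((Subobject.mk_factors_iff _ _).mpr ⟨F.e, F.fac⟩)
    exact HasImage.mk
      { F := { I := I, m := I.arrow, e := I.factorThru f hI }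
        isImage :=
          { lift := fun F => Subobject.ofLE _ _ (hle F) ≫ (Subobject.underlyingIso F.m).hom } }

end LocallyPresentable

section Graphs

namespace VGraph

variable {V : Type u} [Category.{v} V] {W : Type u'} [Category.{v'} W]

theorem mk_eq_mk {A B : VGraph.{w} V} {f : A.obj → B.obj}
    {a b : ∀ x y, A.hom x y ⟶ B.hom (f x) (f y)} (h : ∀ x y, a x y = b x y) :
    (⟨f, a⟩ : Hom A B) = ⟨f, b⟩ :=
  congrArg (Hom.mk f) (funext₂ h)

/-- The adjunction between categories of graphs obtained by applying an adjunction to all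
Hom-objects. -/
def mapAdjunction {F : V ⥤ W} {G : W ⥤ V} (adj : F ⊣ G) :
    mapFunctor.{w} F ⊣ mapFunctor.{w} G where
  unit :=
    { app _ := ⟨id, fun _ _ => adj.unit.app _⟩
      naturality _ _ _ := mk_eq_mk fun _ _ => adj.unit.naturality _ }
  counit :=
    { app _ := ⟨id, fun _ _ => adj.counit.app _⟩
      naturality _ _ _ := mk_eq_mk fun _ _ => adj.counit.naturality _ }
  left_triangle_components _ := mk_eq_mk fun _ _ => adj.left_triangle_components _
  right_triangle_components _ := mk_eq_mk fun _ _ => adj.right_triangle_components _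

instance mapFunctor_isLeftAdjoint (F : V ⥤ W) [F.IsLeftAdjoint] :
    (mapFunctor.{w} F).IsLeftAdjoint :=
  (mapAdjunction (Adjunction.ofIsLeftAdjoint F)).isLeftAdjoint

end VGraph

end Graphs

section Coopposite

variable {V : Type u} [Category.{v} V] [MonoidalCategory V]

theorem comon_hom_ext_of_adj {T : V ⥤ Comon V} (adj : Comon.forget V ⊣ T) {C : Comon V} {X : V}
    {f g : C ⟶ T.obj X} (h : f.hom ≫ adj.counit.app X = g.hom ≫ adj.counit.app X) : f = g :=
  (adj.homEquiv C X).symm.injective <| by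
    rw [Adjunction.homEquiv_counit, Adjunction.homEquiv_counit]
    exact h

variable [SymmetricCategory V]

/-- Twisting the comultiplication twice by the symmetry gives back the original coalgebra. -/
def copCopIso (C : Comon V) : C ≅ (cop V).obj ((cop V).obj C) :=
  Comon.mkIso (Iso.refl C.X) (Category.id_comp _) <| by
    change 𝟙 C.X ≫ (Δ[C.X] ≫ (β_ C.X C.X).hom) ≫ (β_ C.X C.X).hom = Δ[C.X] ≫ (𝟙 C.X ⊗ₘ 𝟙 C.X)
    simp

variable (V) in
/-- The involution `C ↦ C^cop` as a self-equivalence of the category of coalgebras. -/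
def copEquivalence : Comon V ≌ Comon V :=
  .mk (cop V) (cop V)
    (NatIso.ofComponents copCopIso fun _ =>
      Comon.Hom.ext ((Category.comp_id _).trans (Category.id_comp _).symm))
    (NatIso.ofComponents (fun C => (copCopIso C).symm) fun _ =>
      Comon.Hom.ext ((Category.comp_id _).trans (Category.id_comp _).symm))

/-- Since `C ↦ C^cop` does not change underlying objects, it carries cofree coalgebras to cofree
coalgebras. -/
def copAdjunction {T : V ⥤ Comon V} (adj : Comon.forget V ⊣ T) :
    Comon.forget V ⊣ T ⋙ cop V :=
  (copEquivalence V).toAdjunction.comp adj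

theorem copAdjunction_counit_app {T : V ⥤ Comon V} (adj : Comon.forget V ⊣ T) (X : V) :
    (copAdjunction adj).counit.app X = adj.counit.app X :=
  ((copEquivalence V).toAdjunction.comp_counit_app adj X).trans (Category.id_comp _)

theorem exists_involutive_iso_cop {T : V ⥤ Comon V} (adj : Comon.forget V ⊣ T) :
    ∃ t : T ≅ T ⋙ cop V, ∀ X : V, (t.hom.app X).hom ≫ (t.hom.app X).hom = 𝟙 (T.obj X).X := by
  let t := adj.rightAdjointUniq (copAdjunction adj)
  let τ (X : V) : (T.obj X).X ⟶ (T.obj X).X := (t.hom.app X).hom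
  have hτ (X : V) : τ X ≫ adj.counit.app X = adj.counit.app X :=
    (congrArg (τ X ≫ ·) (copAdjunction_counit_app adj X).symm).trans
      (adj.rightAdjointUniq_hom_app_counit (copAdjunction adj) X)
  refine ⟨t, fun X => ?_⟩
  let s : T.obj X ⟶ T.obj X := t.hom.app X ≫ (cop V).map (t.hom.app X) ≫ (copCopIso _).inv
  have hs : s.hom = τ X ≫ τ X := (Category.assoc _ _ _).symm.trans (Category.comp_id _)
  have hs_id : s = 𝟙 _ := comon_hom_ext_of_adj adj <| by
    rw [hs]
    exact (Category.assoc _ _ _).trans <| by rw [hτ, hτ]; exact (Category.id_comp _).symm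
  exact hs.symm.trans (congrArg Comon.Hom.hom hs_id)

end Coopposite

section JointlyEpic

variable {V : Type u} [Category.{v} V]

/-- A family of morphisms `e i : C i ⟶ D` with common codomain is jointly epic if two parallel
morphisms out of `D` agree as soon as all their composites with the `e i` agree. -/
def JointlyEpic {ι : Type w} {C : ι → V} {D : V} (e : ∀ i, C i ⟶ D) : Prop :=
  ∀ ⦃Z : V⦄ (f g : D ⟶ Z), (∀ i, e i ≫ f = e i ≫ g) → f = g

variable [MonoidalCategory V]

/-- The coalgebra structure on `D` for which all members of a jointly epic family of morphisms from
coalgebras to `D` are coalgebra morphisms. -/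
abbrev comonObjOfJointlyEpic {ι : Type w} {C : ι → V} [∀ i, ComonObj (C i)] {D : V}
    {e : ∀ i, C i ⟶ D} (he : JointlyEpic e) (c : D ⟶ 𝟙_ V) (δ : D ⟶ D ⊗ D)
    (hc : ∀ i, e i ≫ c = ε[C i]) (hδ : ∀ i, e i ≫ δ = Δ[C i] ≫ (e i ⊗ₘ e i)) : ComonObj D where
  counit := c
  comul := δ
  counit_comul := he _ _ fun i => by
    rw [reassoc_of% hδ, tensorHom_comp_whiskerRight, hc, counit_comul_hom]
  comul_counit := he _ _ fun i => by
    rw [reassoc_of% hδ, tensorHom_comp_whiskerLeft, hc, comul_counit_hom]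
  comul_assoc := he _ _ fun i => by
    rw [reassoc_of% hδ, reassoc_of% hδ, tensorHom_comp_whiskerLeft,
      tensorHom_comp_whiskerRight_assoc, hδ, ← whiskerLeft_comp_tensorHom,
      ← whiskerRight_comp_tensorHom, Category.assoc, associator_naturality, comul_assoc_assoc]

theorem exists_cocone_of_coalgebras {ι : Type w} (D : ι → Comon V)
    [HasCoproduct fun i => (D i).X] {X : V} (g : ∀ i, (D i).X ⟶ X) :
    ∃ (S : Comon V) (a : ∀ i, D i ⟶ S) (h : S.X ⟶ X), ∀ i, (a i).hom ≫ h = g i := by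
  let inj := Sigma.ι fun i => (D i).X
  have epi : JointlyEpic inj := fun _ _ _ h => Sigma.hom_ext _ _ h
  let _ : ComonObj (∐ fun i => (D i).X) := comonObjOfJointlyEpic epi
    (Sigma.desc fun i => ε[(D i).X]) (Sigma.desc fun i => Δ[(D i).X] ≫ (inj i ⊗ₘ inj i))
    (fun _ => Sigma.ι_desc _ _) fun _ => Sigma.ι_desc _ _
  have (i : ι) : IsComonHom (inj i) := ⟨Sigma.ι_desc _ _, Sigma.ι_desc _ _⟩
  exact ⟨⟨∐ fun i => (D i).X⟩, fun i => ⟨inj i⟩, Sigma.desc g, fun i => Sigma.ι_desc _ _⟩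

end JointlyEpic

section TensorPowers

variable {V : Type u} [Category.{v} V] [MonoidalCategory V]

/-- The tensor powers `X ⊗ (X ⊗ (⋯ ⊗ 𝟙_ V))` of an object. -/
abbrev tensorPow (X : V) : ℕ → V
  | 0 => 𝟙_ V
  | n + 1 => X ⊗ tensorPow X n

/-- Concatenation of tensor powers. The exponent is `m + n` rather than `n + m`, so that recursion
on `n` involves no transport along equalities of natural numbers. -/
def tensorPowConcat (X : V) : ∀ n m : ℕ, tensorPow X n ⊗ tensorPow X m ≅ tensorPow X (m + n)
  | 0, m => λ_ (tensorPow X m)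
  | n + 1, m => α_ X (tensorPow X n) (tensorPow X m) ≪≫ whiskerLeftIso X (tensorPowConcat X n m)

variable {C D X : V} [ComonObj C] [ComonObj D]

/-- The iterated comultiplication of `C` followed by the `n`-th tensor power of `f : C ⟶ X`. -/
def toTensorPow (f : C ⟶ X) : ∀ n : ℕ, C ⟶ tensorPow X n
  | 0 => ε[C]
  | n + 1 => Δ[C] ≫ (f ⊗ₘ toTensorPow f n)

theorem toTensorPow_one (f : C ⟶ X) : toTensorPow f 1 ≫ (ρ_ X).hom = f := by
  simp [toTensorPow]

theorem comp_toTensorPow (e : C ⟶ D) [IsComonHom e] (f : D ⟶ X) (n : ℕ) :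
    e ≫ toTensorPow f n = toTensorPow (e ≫ f) n := by
  induction n with
  | zero => exact IsComonHom.hom_counit e
  | succ n ih =>
    rw [toTensorPow, toTensorPow, IsComonHom.hom_comul_assoc, tensorHom_comp_tensorHom, ih]

theorem comul_toTensorPow (f : C ⟶ X) (n m : ℕ) :
    Δ[C] ≫ (toTensorPow f n ⊗ₘ toTensorPow f m) ≫ (tensorPowConcat X n m).hom =
      toTensorPow f (m + n) := by
  induction n with
  | zero => simp [toTensorPow, tensorPowConcat, tensorPow]
  | succ n ih =>
    calc
      _ = Δ[C] ≫ ((Δ[C] ≫ (f ⊗ₘ toTensorPow f n)) ⊗ₘ toTensorPow f m) ≫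
            (α_ X (tensorPow X n) (tensorPow X m)).hom ≫ X ◁ (tensorPowConcat X n m).hom := rfl
      _ = Δ[C] ≫ (f ⊗ₘ (Δ[C] ≫ (toTensorPow f n ⊗ₘ toTensorPow f m) ≫
            (tensorPowConcat X n m).hom)) := by
        rw [← whiskerRight_comp_tensorHom, Category.assoc, associator_naturality_assoc,
          ← comul_assoc_assoc, tensorHom_comp_whiskerLeft, whiskerLeft_comp_tensorHom]
      _ = toTensorPow f (m + (n + 1)) := by rw [ih]; rfl

theorem comul_tensorHom_toTensorPow (f : C ⟶ X) (n m : ℕ) :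
    Δ[C] ≫ (toTensorPow f n ⊗ₘ toTensorPow f m) =
      toTensorPow f (m + n) ≫ (tensorPowConcat X n m).inv := by
  rw [Iso.eq_comp_inv, Category.assoc, comul_toTensorPow]

end TensorPowers

section Cogenerating

variable {V : Type u} [Category.{v} V] [MonoidalCategory V]

/-- A morphism `g : D ⟶ X` from a coalgebra `D` is cogenerating if the induced morphisms from `D`
to the tensor powers of `X` are jointly monic. -/
def IsCogenerating {D X : V} [ComonObj D] (g : D ⟶ X) : Prop :=
  JointlyMonic (toTensorPow g)

namespace IsCogenerating

theorem hom_ext {C D : Comon V} {X : V} {g : D.X ⟶ X} (hg : IsCogenerating g) {k l : C ⟶ D}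
    (h : k.hom ≫ g = l.hom ≫ g) : k = l :=
  Comon.Hom.ext <| hg _ _ fun n => by rw [comp_toTensorPow, comp_toTensorPow, h]

variable [VeryFlatTensor V]

theorem exists_hom {C D : Comon V} {X : V} {f : C.X ⟶ X} {g : D.X ⟶ X} (hg : IsCogenerating g)
    {e : C.X ⟶ D.X} (he : ∀ n, e ≫ toTensorPow g n = toTensorPow f n) :
    ∃ c : C ⟶ D, c.hom ≫ g = f := by
  have : IsComonHom e :=
    { hom_counit := he 0
      hom_comul := JointlyMonic.tensorHom hg hg _ _ fun ⟨n, m⟩ => by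
        simp only [Category.assoc, tensorHom_comp_tensorHom, comul_tensorHom_toTensorPow, he,
          reassoc_of% he] }
  exact ⟨⟨e⟩, by rw [← toTensorPow_one f, ← he, Category.assoc, toTensorPow_one]⟩

end IsCogenerating

variable [VeryFlatTensor V] [HasCountableProducts V] {X : V}

/-- The comultiplication of `D` is the diagonal filler of `e` against the monomorphism from `D ⊗ D`
into the product of the tensor products of any two tensor powers of `X`. -/
theorem exists_comonObj_of_strongEpi {C : V} [ComonObj C] (f : C ⟶ X) {D : V} (e : C ⟶ D)
    [StrongEpi e] {d : ∀ n, D ⟶ tensorPow X n} (hd : JointlyMonic d)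
    (hed : ∀ n, e ≫ d n = toTensorPow f n) :
    ∃ (_ : ComonObj D) (g : D ⟶ X), IsComonHom e ∧ e ≫ g = f ∧ IsCogenerating g := by
  obtain ⟨δ, hδ⟩ : ∃ δ, e ≫ δ = Δ[C] ≫ (e ⊗ₘ e) :=
    (hd.tensorHom hd).exists_lift_of_strongEpi e
      (b := fun p => d (p.2 + p.1) ≫ (tensorPowConcat X p.1 p.2).inv) fun p => by
        simp only [Category.assoc, tensorHom_comp_tensorHom, hed, reassoc_of% hed,
          comul_tensorHom_toTensorPow]
  have epi : JointlyEpic fun _ : Unit => e := fun _ _ _ h => (cancel_epi e).mp (h ())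
  let _ : ComonObj D := comonObjOfJointlyEpic epi (d 0) δ (fun _ => hed 0) fun _ => hδ
  have he : IsComonHom e := ⟨hed 0, hδ⟩
  have hf : e ≫ d 1 ≫ (ρ_ X).hom = f := by rw [reassoc_of% hed 1, toTensorPow_one]
  have hg : toTensorPow (d 1 ≫ (ρ_ X).hom) = d := funext fun n => by
    rw [← cancel_epi e, comp_toTensorPow, hf, hed]
  exact ⟨inferInstance, d 1 ≫ (ρ_ X).hom, he, hf, by rwa [IsCogenerating, hg]⟩

theorem exists_isCogenerating_quotient [HasImages V] [HasStrongEpiImages V] (C : Comon V)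
    (f : C.X ⟶ X) :
    ∃ (D : Comon V) (e : C ⟶ D) (g : D.X ⟶ X), e.hom ≫ g = f ∧ IsCogenerating g := by
  let m : C.X ⟶ ∏ᶜ tensorPow X := Pi.lift (toTensorPow f)
  obtain ⟨_, g, _, hf, hg⟩ := exists_comonObj_of_strongEpi f (factorThruImage m)
    (JointlyMonic.pi_π.mono_comp (image.ι m)) fun n => by simp [m]
  exact ⟨⟨image m⟩, ⟨factorThruImage m⟩, g, hf, hg⟩

/-- The subobject of the product of all tensor powers of `X` given by a coalgebra with a
cogenerating morphism to `X`. -/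
noncomputable def IsCogenerating.subobject {D : V} [ComonObj D] {g : D ⟶ X}
    (hg : IsCogenerating g) : Subobject (∏ᶜ tensorPow X) :=
  have := hg.mono_piLift
  Subobject.mk (Pi.lift (toTensorPow g))

theorem IsCogenerating.exists_hom_of_subobject_le {C D : Comon V} {f : C.X ⟶ X} {g : D.X ⟶ X}
    (hf : IsCogenerating f) (hg : IsCogenerating g) (h : hf.subobject ≤ hg.subobject) :
    ∃ c : C ⟶ D, c.hom ≫ g = f := by
  have := hf.mono_piLift
  have := hg.mono_piLift
  let e : C.X ⟶ D.X := Subobject.ofMkLEMk _ _ h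
  have he : e ≫ Pi.lift (toTensorPow g) = Pi.lift (toTensorPow f) := Subobject.ofMkLEMk_comp _
  exact hg.exists_hom fun n => by simpa using congrArg (· ≫ Pi.π _ n) he

theorem exists_small_family_isCogenerating [WellPowered.{v} V] (X : V) :
    ∃ (ι : Type v) (D : ι → Comon V) (g : ∀ i, (D i).X ⟶ X),
      ∀ (C : Comon V) (f : C.X ⟶ X), IsCogenerating f → ∃ i, ∃ c : C ⟶ D i, c.hom ≫ g i = f := by
  let φ (p : {p : Σ D : Comon V, D.X ⟶ X // IsCogenerating p.2}) := p.2.subobject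
  let r (i : Shrink.{v} (Set.range φ)) := Set.rangeSplitting φ ((equivShrink.{v} _).symm i)
  refine ⟨Shrink.{v} (Set.range φ), fun i => (r i).1.1, fun i => (r i).1.2, fun C f hf => ?_⟩
  let i := equivShrink.{v} (Set.range φ) ⟨hf.subobject, ⟨⟨C, f⟩, hf⟩, rfl⟩
  have hi : φ (r i) = hf.subobject := by simp [r, i, Set.apply_rangeSplitting]
  exact ⟨i, hf.exists_hom_of_subobject_le (r i).2 hi.ge⟩

variable [HasImages V] [HasStrongEpiImages V] [HasCoproducts.{v} V] [WellPowered.{v} V]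

theorem exists_weaklyTerminal_isCogenerating (X : V) :
    ∃ (T : Comon V) (t : T.X ⟶ X), IsCogenerating t ∧
      ∀ (C : Comon V) (f : C.X ⟶ X), ∃ k : C ⟶ T, k.hom ≫ t = f := by
  obtain ⟨ι, D, g, hD⟩ := exists_small_family_isCogenerating X
  obtain ⟨S, a, s, ha⟩ := exists_cocone_of_coalgebras D g
  obtain ⟨T, q, t, hq, ht⟩ := exists_isCogenerating_quotient S s
  refine ⟨T, t, ht, fun C f => ?_⟩
  obtain ⟨E, e, h, he, hh⟩ := exists_isCogenerating_quotient C f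
  obtain ⟨i, c, hc⟩ := hD E h hh
  exact ⟨e ≫ c ≫ a i ≫ q, by simp [hq, ha, hc, he]⟩

theorem hasTerminal_costructuredArrow_comon_forget (X : V) :
    HasTerminal (CostructuredArrow (Comon.forget V) X) := by
  obtain ⟨T, t, ht, hT⟩ := exists_weaklyTerminal_isCogenerating X
  choose k hk using hT
  exact IsTerminal.hasTerminal (X := CostructuredArrow.mk (S := Comon.forget V) (Y := T) t) <|
    IsTerminal.ofUniqueHom (fun A => CostructuredArrow.homMk (k A.left A.hom) (hk _ _))
      fun _ m => CostructuredArrow.hom_ext _ _ <|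
        ht.hom_ext ((CostructuredArrow.w m).trans (hk _ _).symm)

variable (V) in
theorem comon_forget_isLeftAdjoint : (Comon.forget V).IsLeftAdjoint :=
  have := hasTerminal_costructuredArrow_comon_forget (V := V)
  isLeftAdjoint_of_costructuredArrowTerminals _

end Cogenerating

theorem corollary2p6_general (V : Type u) [Category.{v} V] [MonoidalCategory V]
    [HasCountableProducts V] [HasCoproducts.{v} V] [HasImages V] [HasStrongEpiImages V]
    [WellPowered.{v} V] [VeryFlatTensor V] :
    (Comon.forget V).IsLeftAdjoint ∧
    (∀ [SymmetricCategory V] (Tc : V ⥤ Comon V) (_ : Comon.forget V ⊣ Tc),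
      ∃ t : Tc ≅ Tc ⋙ cop V,
        ∀ X : V, (t.hom.app X).hom ≫ (t.hom.app X).hom = 𝟙 (Tc.obj X).X) ∧
    (VGraph.mapFunctor.{w} (Comon.forget V)).IsLeftAdjoint :=
  have := comon_forget_isLeftAdjoint V
  ⟨this, fun _ adj => exists_involutive_iso_cop adj, inferInstance⟩

theorem corollary2p6 (V : Type u) [Category.{v} V] [MonoidalCategory V] [MonoidalClosed V]
    [IsLocallyPresentable.{v} V] [VeryFlatTensor V] :
    -- the cofree coalgebra functor `Tc` exists
    (Comon.forget V).IsLeftAdjoint ∧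
    -- an involutive natural isomorphism of coalgebras `Tc X ≅ (Tc X)^cop`
    (∀ [SymmetricCategory V] (Tc : V ⥤ Comon V) (_ : Comon.forget V ⊣ Tc),
      ∃ t : Tc ≅ Tc ⋙ cop V,
        ∀ X : V, (t.hom.app X).hom ≫ (t.hom.app X).hom = 𝟙 (Tc.obj X).X) ∧
    -- the forgetful functor from `Coalg(V)`-graphs to `V`-graphs has a right adjoint
    (VGraph.mapFunctor.{w} (Comon.forget V)).IsLeftAdjoint :=
  corollary2p6_general V
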